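/- Let $\mathbb N=\{1,2,\dots\}$ and $\mathbb N_0=\mathbb N\cup\{0\}$. Let \[ s=\Big\{\xi\in\mathbb C^{\mathbb N}:\ |\xi|_q:=\Big(\sum_{j=1}^\infty|\xi_j|^2j^{2q}\Big)^{1/2}<\infty\ \text{ for all } q\in\mathbb N_0\Big\} \] be the space of rapidly decreasing sequences with the topology given by the norms $(|\cdot|_q)_{q\in\mathbb N_0}$, and for a sequence $(n_k)_{k\in\mathbb N}$ of positive integers let \[ \lambda^\infty(n_k^q)=\Big\{\xi\in\mathbb C^{\mathbb N}:\ |\xi|_{\infty,q}:=\sup_{k\in\mathbb N}|\xi_k|\,n_k^q<\infty\ \text{ for all } q\in\mathbb N_0\Big\} \] with the topology given by the norms $(|\cdot|_{\infty,q})_{q\in\mathbb N_0}$. With pointwise multiplication and complex conjugation both are Fréchet ${}^*$-algebras. An isomorphism of Fréchet ${}^*$-algebras is a linear, multiplicative, ${}^*$-preserving bijection that is a homeomorphism; subalgebras of $s$ need not be unital and carry the subspace topology. (1) Every infinite-dimensional closed ${}^*$-subalgebra of $s$ is isomorphic as a Fréchet ${}^*$-algebra to $\lambda^\infty(n_k^q)$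 for some strictly increasing sequence $(n_k)_{k\in\mathbb N}$ of positive integers. (2) Conversely, for every strictly increasing sequence $(n_k)_{k\in\mathbb N}$ of positive integers, $\lambda^\infty(n_k^q)$ is isomorphic as a Fréchet ${}^*$-algebra to some infinite-dimensional closed ${}^*$-subalgebra of $s$. (3) Every closed ${}^*$-subalgebra $E$ of $s$ (of finite or infinite dimension) is a complemented subspace of $s$, i.e. there is a continuous linear projection of $s$ onto $E$. -/

import Mathlib

noncomputable section

/-! ### The space `s` of rapidly decreasing sequences

Sequences are indexed by the positive integers `ℕ+`. All algebra operations on sequences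
(multiplication, conjugation) are pointwise, i.e. those of `ℕ+ → ℂ`. -/

namespace RapidSeq

theorem sq_norm_le {ξ : ℕ+ → ℂ}
    (h : ∀ q : ℕ, Summable fun j : ℕ+ => ‖ξ j‖ ^ 2 * (j : ℝ) ^ (2 * q)) (j : ℕ+) :
    ‖ξ j‖ ^ 2 ≤ ∑' i : ℕ+, ‖ξ i‖ ^ 2 := by
  have h0 : Summable fun i : ℕ+ => ‖ξ i‖ ^ 2 := by simpa using h 0
  exact h0.le_tsum j fun i _ => by positivity

/-- The sequences `ξ` with `∑ |ξ_j|² j^{2q} < ∞` for all `q ∈ ℕ₀`, as a `*`-subalgebra of the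
algebra of all sequences. -/
def carrier : NonUnitalStarSubalgebra ℂ (ℕ+ → ℂ) where
  carrier := {ξ | ∀ q : ℕ, Summable fun j : ℕ+ => ‖ξ j‖ ^ 2 * (j : ℝ) ^ (2 * q)}
  zero_mem' := fun q => by simp
  add_mem' := by
    intro ξ η hξ hη q
    refine Summable.of_nonneg_of_le (fun j => by positivity) (fun j => ?_)
      (((hξ q).add (hη q)).mul_left 2)
    have h1 : ‖(ξ + η) j‖ ^ 2 ≤ 2 * (‖ξ j‖ ^ 2 + ‖η j‖ ^ 2) := by
      have h2 : ‖(ξ + η) j‖ ≤ ‖ξ j‖ + ‖η j‖ := norm_add_le _ _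
      nlinarith [sq_nonneg (‖ξ j‖ - ‖η j‖), norm_nonneg ((ξ + η) j)]
    calc ‖(ξ + η) j‖ ^ 2 * (j : ℝ) ^ (2 * q)
        ≤ (2 * (‖ξ j‖ ^ 2 + ‖η j‖ ^ 2)) * (j : ℝ) ^ (2 * q) :=
          mul_le_mul_of_nonneg_right h1 (by positivity)
      _ = _ := by ring
  smul_mem' := by
    intro c ξ hξ q
    refine ((hξ q).mul_left (‖c‖ ^ 2)).congr fun j => ?_
    simp only [Pi.smul_apply, norm_smul]
    ring
  mul_mem' := by
    intro ξ η hξ hη q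
    refine Summable.of_nonneg_of_le (fun j => by positivity) (fun j => ?_)
      ((hη q).mul_left (∑' i : ℕ+, ‖ξ i‖ ^ 2))
    have h1 := sq_norm_le hξ j
    simp only [Pi.mul_apply, norm_mul, mul_pow, mul_assoc]
    exact mul_le_mul_of_nonneg_right h1 (by positivity)
  star_mem' := by
    intro ξ hξ q
    simpa using hξ q

end RapidSeq

/-- The space `s` of rapidly decreasing sequences. It is a separate type, so that it does not
inherit the topology of pointwise convergence from `ℕ+ → ℂ`. -/
def RapidSeq : Type := RapidSeq.carrier

namespace RapidSeq

instance : NonUnitalCommRing RapidSeq := inferInstanceAs (NonUnitalCommRing carrier)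
instance : Module ℂ RapidSeq := inferInstanceAs (Module ℂ carrier)
instance : StarRing RapidSeq := inferInstanceAs (StarRing carrier)

instance : CoeFun RapidSeq (fun _ => ℕ+ → ℂ) := ⟨fun ξ => ξ.1⟩

/-- The norm `|ξ|_q = (∑ |ξ_j|² j^{2q})^{1/2}` on `s`. -/
def seminorm : SeminormFamily ℂ RapidSeq ℕ := fun q =>
  Seminorm.of (fun ξ => Real.sqrt (∑' j : ℕ+, ‖ξ j‖ ^ 2 * (j : ℝ) ^ (2 * q)))
    (by
      intro ξ η
      have key : ∀ (ζ : RapidSeq) (j : ℕ+),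
          (‖ζ j‖ * (j : ℝ) ^ q) ^ (2 : ℝ) = ‖ζ j‖ ^ 2 * (j : ℝ) ^ (2 * q) := by
        intro ζ j
        rw [Real.rpow_two]
        ring
      have hs : ∀ ζ : RapidSeq, Summable fun j : ℕ+ => (‖ζ j‖ * (j : ℝ) ^ q) ^ (2 : ℝ) :=
        fun ζ => (ζ.2 q).congr fun j => (key ζ j).symm
      have M := Real.Lp_add_le_tsum_of_nonneg (p := 2) (by norm_num)
        (f := fun j : ℕ+ => ‖ξ j‖ * (j : ℝ) ^ q) (g := fun j : ℕ+ => ‖η j‖ * (j : ℝ) ^ q)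
        (fun j => by positivity) (fun j => by positivity) (hs ξ) (hs η)
      simp only [key, ← Real.sqrt_eq_rpow] at M
      refine le_trans (Real.sqrt_le_sqrt ?_) M.2
      refine ((ξ + η).2 q).tsum_le_tsum (fun j => ?_) M.1
      rw [← key]
      refine Real.rpow_le_rpow (by positivity) ?_ (by norm_num)
      rw [← add_mul]
      exact mul_le_mul_of_nonneg_right (norm_add_le (ξ j) (η j)) (by positivity))
    (by
      intro c ξ
      have h : ∀ j : ℕ+, ‖(c • ξ) j‖ ^ 2 * (j : ℝ) ^ (2 * q)
          = ‖c‖ ^ 2 * (‖ξ j‖ ^ 2 * (j : ℝ) ^ (2 * q)) := by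
        intro j
        have : (c • ξ) j = c * ξ j := rfl
        rw [this, norm_mul]
        ring
      simp only [h, tsum_mul_left]
      rw [Real.sqrt_mul (by positivity), Real.sqrt_sq (norm_nonneg c)])

/-- The topology of `s` is the one given by the norms `|·|_q`, `q ∈ ℕ₀`. -/
instance : TopologicalSpace RapidSeq := seminorm.moduleFilterBasis.topology

end RapidSeq

/-! ### Köthe spaces `λ^∞(A)` -/

/-- A Köthe matrix `(a_{j,q})`, `j ∈ ℕ`, `q ∈ ℕ₀`. -/
structure KotheMatrix where
  entry : ℕ+ → ℕ → ℝ
  nonneg : ∀ j q, 0 ≤ entry j q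
  exists_pos : ∀ j, ∃ q, 0 < entry j q
  mono : ∀ j q, entry j q ≤ entry j (q + 1)

namespace KotheMatrix

/-- All the entries of the matrix are at least `1`. Then `λ^∞(A)` is closed under pointwise
multiplication. -/
class OneLE (A : KotheMatrix) : Prop where
  one_le : ∀ j q, 1 ≤ A.entry j q

/-- The Köthe matrix `(n_k^q)` of a sequence `n` of positive integers. -/
def powers (n : ℕ+ → ℕ+) : KotheMatrix where
  entry := fun k q => (n k : ℝ) ^ q
  nonneg := fun k q => by positivity
  exists_pos := fun k => ⟨0, by simp⟩
  mono := fun k q => pow_le_pow_right₀ (by exact_mod_cast (n k).pos) (Nat.le_succ q)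

instance (n : ℕ+ → ℕ+) : (powers n).OneLE :=
  ⟨fun k _ => one_le_pow₀ (by exact_mod_cast (n k).pos)⟩

end KotheMatrix

namespace LambdaInf

/-- The sequences `ξ` with `sup_j |ξ_j| a_{j,q} < ∞` for all `q ∈ ℕ₀`. -/
def carrier (A : KotheMatrix) : Submodule ℂ (ℕ+ → ℂ) where
  carrier := {ξ | ∀ q : ℕ, BddAbove (Set.range fun j : ℕ+ => ‖ξ j‖ * A.entry j q)}
  zero_mem' := fun q => ⟨0, by rintro _ ⟨j, rfl⟩; simp⟩
  add_mem' := by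
    intro ξ η hξ hη q
    obtain ⟨C, hC⟩ := hξ q
    obtain ⟨D, hD⟩ := hη q
    refine ⟨C + D, ?_⟩
    rintro _ ⟨j, rfl⟩
    have h1 : ‖ξ j‖ * A.entry j q ≤ C := hC ⟨j, rfl⟩
    have h2 : ‖η j‖ * A.entry j q ≤ D := hD ⟨j, rfl⟩
    have h3 : ‖(ξ + η) j‖ ≤ ‖ξ j‖ + ‖η j‖ := norm_add_le _ _
    have h4 := mul_le_mul_of_nonneg_right h3 (A.nonneg j q)
    simp only
    linarith
  smul_mem' := by
    intro c ξ hξ q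
    obtain ⟨C, hC⟩ := hξ q
    refine ⟨‖c‖ * C, ?_⟩
    rintro _ ⟨j, rfl⟩
    have h1 : ‖ξ j‖ * A.entry j q ≤ C := hC ⟨j, rfl⟩
    simp only [Pi.smul_apply, norm_smul, mul_assoc]
    exact mul_le_mul_of_nonneg_left h1 (norm_nonneg c)

/-- If the entries of `A` are at least `1`, the space `λ^∞(A)` as a `*`-subalgebra of the algebra
of all sequences. -/
def carrierAlg (A : KotheMatrix) [A.OneLE] : NonUnitalStarSubalgebra ℂ (ℕ+ → ℂ) where
  toSubmodule := carrier A
  mul_mem' := by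
    intro ξ η hξ hη q
    obtain ⟨C, hC⟩ := hξ q
    obtain ⟨D, hD⟩ := hη q
    refine ⟨C * D, ?_⟩
    rintro _ ⟨j, rfl⟩
    have h1 : ‖ξ j‖ * A.entry j q ≤ C := hC ⟨j, rfl⟩
    have h2 : ‖η j‖ * A.entry j q ≤ D := hD ⟨j, rfl⟩
    have h3 : ‖ξ j‖ ≤ ‖ξ j‖ * A.entry j q :=
      le_mul_of_one_le_right (norm_nonneg _) (KotheMatrix.OneLE.one_le j q)
    simp only [Pi.mul_apply, norm_mul, mul_assoc]
    exact mul_le_mul (h3.trans h1) h2 (mul_nonneg (norm_nonneg _) (A.nonneg j q))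
      ((norm_nonneg _).trans (h3.trans h1))
  star_mem' := by
    intro ξ hξ q
    simpa using hξ q

end LambdaInf

/-- The Köthe space `λ^∞(A)`, a separate type for the same reason as `RapidSeq`. -/
def LambdaInf (A : KotheMatrix) : Type := LambdaInf.carrier A

namespace LambdaInf

variable (A : KotheMatrix)

instance : AddCommGroup (LambdaInf A) := inferInstanceAs (AddCommGroup (carrier A))
instance : Module ℂ (LambdaInf A) := inferInstanceAs (Module ℂ (carrier A))

instance : CoeFun (LambdaInf A) (fun _ => ℕ+ → ℂ) := ⟨fun ξ => ξ.1⟩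

instance [A.OneLE] : NonUnitalCommRing (LambdaInf A) :=
  inferInstanceAs (NonUnitalCommRing (carrierAlg A))
instance [A.OneLE] : StarRing (LambdaInf A) := inferInstanceAs (StarRing (carrierAlg A))

/-- The seminorm `|ξ|_{∞,q} = sup_j |ξ_j| a_{j,q}` on `λ^∞(A)`. -/
def seminorm : SeminormFamily ℂ (LambdaInf A) ℕ := fun q =>
  Seminorm.of (fun ξ => ⨆ j : ℕ+, ‖ξ j‖ * A.entry j q)
    (by
      intro ξ η
      refine ciSup_le fun j => ?_
      have h3 : ‖(ξ + η) j‖ ≤ ‖ξ j‖ + ‖η j‖ := norm_add_le (ξ j) (η j)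
      calc ‖(ξ + η) j‖ * A.entry j q ≤ (‖ξ j‖ + ‖η j‖) * A.entry j q :=
            mul_le_mul_of_nonneg_right h3 (A.nonneg j q)
        _ = ‖ξ j‖ * A.entry j q + ‖η j‖ * A.entry j q := add_mul _ _ _
        _ ≤ _ := add_le_add (le_ciSup (ξ.2 q) j) (le_ciSup (η.2 q) j))
    (by
      intro c ξ
      rw [Real.mul_iSup_of_nonneg (norm_nonneg c)]
      congr 1
      funext j
      have : (c • ξ) j = c * ξ j := rfl
      rw [this, norm_mul, mul_assoc])

/-- The topology of `λ^∞(A)` is the one given by the seminorms `|·|_{∞,q}`, `q ∈ ℕ₀`. -/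
instance : TopologicalSpace (LambdaInf A) := (seminorm A).moduleFilterBasis.topology

end LambdaInf

/-! ### Isomorphisms -/

/-- `X` and `Y` are isomorphic as topological (in particular, as Fréchet) `*`-algebras: there is
a linear, multiplicative, `*`-preserving bijection which is a homeomorphism. -/
def FrechetStarIso (X Y : Type*) [NonUnitalRing X] [StarRing X] [Module ℂ X] [TopologicalSpace X]
    [NonUnitalRing Y] [StarRing Y] [Module ℂ Y] [TopologicalSpace Y] : Prop :=
  ∃ Φ : X ≃⋆ₐ[ℂ] Y, Continuous Φ ∧ Continuous Φ.symm

end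

/-! Elements of `s` tend to zero, so a nonzero value is taken only finitely often. Hence the indices
that a subalgebra `E` fails to separate form finite blocks, apart from those where all of `E`
vanishes. If `E` is closed, it contains the indicator of every level set `{ξ = 1}`
(`indicator_eq_one_mem`), and a smallest such set around `j` is the block of `j`
(`indicator_block_mem`). Summing block indicators and passing to the limit shows that `E` consists
of all sequences constant on blocks and zero off the support (`mem_of_const_on_blocks`).

Represent each block by its largest index and let `n` enumerate the representatives. Restriction to
them is continuous into `λ^∞(n_k^q)`. Its inverse spreads each value over its block; it is
continuous because `j ≤ n_k` on the `k`-th block, while passing from sup norms to `ℓ²` norms costs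
one power of `j`. The same spreading gives the projection onto `E`. Conversely, the sequences
supported in the range of `n` form a closed subalgebra whose blocks are singletons. -/

theorem WithSeminorms.continuous_of_le {X Y : Type*} [AddCommGroup X] [Module ℂ X]
    [TopologicalSpace X] [AddCommGroup Y] [Module ℂ Y] [TopologicalSpace Y]
    {p : SeminormFamily ℂ X ℕ} {p' : SeminormFamily ℂ Y ℕ} (hp : WithSeminorms p)
    (hp' : WithSeminorms p') (f : X →ₗ[ℂ] Y)
    (h : ∀ q : ℕ, ∃ (r : ℕ) (C : ℝ), ∀ x, p' q (f x) ≤ C * p r x) : Continuous f := by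
  refine hp.continuous_of_isBounded hp' f (Seminorm.IsBounded.of_real fun q => ?_)
  obtain ⟨r, C, hr⟩ := h q
  exact ⟨{r}, C, by simpa using hr⟩

/-! ### Estimates and topology of `s`. -/

namespace RapidSeq

@[simp] theorem zero_apply (j : ℕ+) : (0 : RapidSeq) j = 0 := rfl
@[simp] theorem add_apply (ξ η : RapidSeq) (j : ℕ+) : (ξ + η) j = ξ j + η j := rfl
@[simp] theorem sub_apply (ξ η : RapidSeq) (j : ℕ+) : (ξ - η) j = ξ j - η j := rfl
@[simp] theorem smul_apply (c : ℂ) (ξ : RapidSeq) (j : ℕ+) : (c • ξ) j = c * ξ j := rfl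
@[simp] theorem mul_apply (ξ η : RapidSeq) (j : ℕ+) : (ξ * η) j = ξ j * η j := rfl
@[simp] theorem star_apply (ξ : RapidSeq) (j : ℕ+) : (star ξ) j = star (ξ j) := rfl

theorem ext {ξ η : RapidSeq} (h : ∀ j, ξ j = η j) : ξ = η := Subtype.ext (funext h)

theorem withSeminorms : WithSeminorms seminorm := ⟨rfl⟩

theorem seminorm_apply (q : ℕ) (ξ : RapidSeq) :
    seminorm q ξ = Real.sqrt (∑' j : ℕ+, ‖ξ j‖ ^ 2 * (j : ℝ) ^ (2 * q)) := rfl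

theorem norm_mul_pow_le_seminorm (q : ℕ) (ξ : RapidSeq) (j : ℕ+) :
    ‖ξ j‖ * (j : ℝ) ^ q ≤ seminorm q ξ := by
  rw [seminorm_apply]
  refine Real.le_sqrt_of_sq_le ?_
  have := (ξ.2 q).le_tsum j fun i _ => by positivity
  refine le_trans (le_of_eq ?_) this
  ring

theorem seminorm_le_of_norm_le {q : ℕ} {ξ η : RapidSeq} {c : ℝ} (hc : 0 ≤ c)
    (h : ∀ j, ‖ξ j‖ ≤ c * ‖η j‖) : seminorm q ξ ≤ c * seminorm q η := by
  rw [seminorm_apply, seminorm_apply]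
  refine Real.sqrt_le_iff.2 ⟨by positivity, ?_⟩
  rw [mul_pow, Real.sq_sqrt (tsum_nonneg fun j => by positivity), ← tsum_mul_left]
  refine (ξ.2 q).tsum_le_tsum (fun j => ?_) ((η.2 q).mul_left _)
  have := pow_le_pow_left₀ (norm_nonneg _) (h j) 2
  calc ‖ξ j‖ ^ 2 * (j : ℝ) ^ (2 * q) ≤ (c * ‖η j‖) ^ 2 * (j : ℝ) ^ (2 * q) := by gcongr
    _ = _ := by ring

theorem summable_inv_sq : Summable fun j : ℕ+ => ((j : ℝ) ^ 2)⁻¹ :=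
  (Real.summable_nat_pow_inv.2 one_lt_two).comp_injective PNat.coe_injective

theorem one_le_coe (j : ℕ+) : (1 : ℝ) ≤ (j : ℝ) := by exact_mod_cast (one_le : 1 ≤ j)

/-- The one extra power of `j` leaves the summable factor `j⁻²`, so sup bounds control the `ℓ²`
norms. -/
theorem sq_mul_pow_le {x C : ℝ} {q : ℕ} {j : ℕ+} (hx : 0 ≤ x)
    (h : x * (j : ℝ) ^ (q + 1) ≤ C) : x ^ 2 * (j : ℝ) ^ (2 * q) ≤ C ^ 2 * ((j : ℝ) ^ 2)⁻¹ := by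
  have hj : (0 : ℝ) < j := by exact_mod_cast j.pos
  rw [← div_eq_mul_inv, le_div_iff₀ (by positivity)]
  have := pow_le_pow_left₀ (by positivity) h 2
  refine le_trans (le_of_eq ?_) this
  ring

/-- The rapidly decreasing sequence with given terms, from bounds on the weighted terms. -/
def ofBounds (f : ℕ+ → ℂ) (h : ∀ q : ℕ, ∃ C : ℝ, ∀ j : ℕ+, ‖f j‖ * (j : ℝ) ^ q ≤ C) : RapidSeq :=
  ⟨f, fun q => by
    obtain ⟨C, hC⟩ := h (q + 1)
    exact Summable.of_nonneg_of_le (fun j => by positivity)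
      (fun j => sq_mul_pow_le (norm_nonneg _) (hC j)) (summable_inv_sq.mul_left (C ^ 2))⟩

@[simp] theorem ofBounds_apply (f : ℕ+ → ℂ) (h) (j : ℕ+) : ofBounds f h j = f j := rfl

theorem seminorm_le_of_bound {q : ℕ} {ξ : RapidSeq} {C : ℝ} (hC : 0 ≤ C)
    (h : ∀ j : ℕ+, ‖ξ j‖ * (j : ℝ) ^ (q + 1) ≤ C) :
    seminorm q ξ ≤ Real.sqrt (∑' j : ℕ+, ((j : ℝ) ^ 2)⁻¹) * C := by
  rw [seminorm_apply, mul_comm _ C, ← Real.sqrt_sq hC, ← Real.sqrt_mul (sq_nonneg C),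
    ← tsum_mul_left]
  exact Real.sqrt_le_sqrt ((ξ.2 q).tsum_le_tsum
    (fun j => sq_mul_pow_le (norm_nonneg _) (h j)) (summable_inv_sq.mul_left (C ^ 2)))

theorem seminorm_mono : Monotone seminorm := by
  refine monotone_nat_of_le_succ fun q ξ => ?_
  rw [seminorm_apply, seminorm_apply]
  refine Real.sqrt_le_sqrt ((ξ.2 q).tsum_le_tsum (fun j => ?_) (ξ.2 (q + 1)))
  gcongr
  · exact one_le_coe j
  · omega

/-- The norms increase with `q`, so approximating in one norm at a time suffices. -/
theorem mem_of_isClosed {T : Set RapidSeq} (hT : IsClosed T) {ξ : RapidSeq}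
    (h : ∀ q : ℕ, ∀ ε > 0, ∃ η ∈ T, seminorm q (η - ξ) < ε) : ξ ∈ T := by
  rw [← hT.closure_eq, mem_closure_iff_nhds_basis (withSeminorms.hasBasis_ball (x := ξ))]
  rintro ⟨s, ε⟩ hε
  obtain ⟨η, hη, hlt⟩ := h (s.sup id) ε hε
  refine ⟨η, hη, ?_⟩
  rw [Seminorm.mem_ball]
  refine lt_of_le_of_lt ?_ hlt
  exact Finset.sup_le (fun i hi => seminorm_mono (Finset.le_sup (f := id) hi)) (η - ξ)

/-- Evaluation at a coordinate as a linear functional. -/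
def evalₗ (j : ℕ+) : RapidSeq →ₗ[ℂ] ℂ where
  toFun ξ := ξ j
  map_add' _ _ := rfl
  map_smul' _ _ := rfl

theorem continuous_apply (j : ℕ+) : Continuous fun ξ : RapidSeq => ξ j := by
  refine WithSeminorms.continuous_of_isBounded withSeminorms (norm_withSeminorms ℂ ℂ) (evalₗ j)
    (Seminorm.IsBounded.of_real fun _ => ⟨{0}, 1, fun ξ => ?_⟩)
  have h := norm_mul_pow_le_seminorm 0 ξ j
  rw [pow_zero, mul_one] at h
  rw [one_mul, Finset.sup_singleton]
  exact h

theorem finite_norm_ge (ξ : RapidSeq) {ε : ℝ} (hε : 0 < ε) : {j : ℕ+ | ε ≤ ‖ξ j‖}.Finite := by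
  obtain ⟨N, hN⟩ := exists_nat_gt (seminorm 1 ξ / ε)
  refine ((Set.finite_Iic N).preimage (PNat.coe_injective.injOn)).subset fun j hj => ?_
  have h1 := norm_mul_pow_le_seminorm 1 ξ j
  rw [div_lt_iff₀ hε] at hN
  have hj' : ε ≤ ‖ξ j‖ := hj
  have h2 : ε * j ≤ ε * N := by
    have : ε * (j : ℝ) ≤ ‖ξ j‖ * (j : ℝ) ^ 1 := by rw [pow_one]; gcongr
    linarith
  have := le_of_mul_le_mul_left h2 hε
  exact_mod_cast this

end RapidSeq

namespace LambdaInf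

variable {A : KotheMatrix}

theorem withSeminorms : WithSeminorms (seminorm A) := ⟨rfl⟩

theorem norm_mul_entry_le_seminorm (q : ℕ) (ξ : LambdaInf A) (j : ℕ+) :
    ‖ξ j‖ * A.entry j q ≤ seminorm A q ξ := le_ciSup (ξ.2 q) j

theorem ext {ξ η : LambdaInf A} (h : ∀ j, ξ j = η j) : ξ = η := Subtype.ext (funext h)

end LambdaInf

namespace RapidSeq

/-! ### Idempotents in closed subalgebras -/

variable {E : NonUnitalStarSubalgebra ℂ RapidSeq}

/-- `E` need not have a unit; the factor `ξ i` in front makes this a polynomial in `ξ` without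
constant term. For `1 ∉ V` its value at `1` is `1`. -/
theorem exists_mem_eq_mul_prod {ξ : RapidSeq} (hξ : ξ ∈ E) (V : Finset ℂ) :
    ∃ ζ ∈ E, ∀ i, ζ i = ξ i * ∏ v ∈ V, (ξ i - v) / (1 - v) := by
  induction V using Finset.induction_on with
  | empty => exact ⟨ξ, hξ, by simp⟩
  | insert v V hv ih =>
    obtain ⟨ζ, hζ, h⟩ := ih
    refine ⟨(1 - v)⁻¹ • (ξ * ζ - v • ζ),
      SMulMemClass.smul_mem _ (sub_mem (mul_mem hξ hζ) (SMulMemClass.smul_mem v hζ)), fun i => ?_⟩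
    rw [Finset.prod_insert hv, smul_apply, sub_apply, mul_apply, smul_apply, h]
    ring

theorem exists_mem_eq_pow_mul {ξ ζ : RapidSeq} (hξ : ξ ∈ E) (hζ : ζ ∈ E) (m : ℕ) :
    ∃ η ∈ E, ∀ i, η i = ξ i ^ m * ζ i := by
  induction m with
  | zero => exact ⟨ζ, hζ, by simp⟩
  | succ m ih =>
    obtain ⟨η, hη, h⟩ := ih
    refine ⟨ξ * η, mul_mem hξ hη, fun i => ?_⟩
    rw [mul_apply, h]
    ring

open Classical in
/-- The indicator sequence of a finite set. -/
noncomputable def indicator {T : Set ℕ+} (hT : T.Finite) : RapidSeq :=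
  ofBounds (fun i => if i ∈ T then 1 else 0) fun q => by
    obtain ⟨C, hC⟩ := (hT.image fun j : ℕ+ => (j : ℝ) ^ q).bddAbove
    refine ⟨max C 0, fun j => ?_⟩
    by_cases hj : j ∈ T
    · simpa [hj] using Or.inl (hC ⟨j, hj, rfl⟩)
    · simp [hj]

theorem indicator_of_mem {T : Set ℕ+} (hT : T.Finite) {i : ℕ+} (hi : i ∈ T) :
    indicator hT i = 1 := if_pos hi

theorem indicator_of_notMem {T : Set ℕ+} (hT : T.Finite) {i : ℕ+} (hi : i ∉ T) :
    indicator hT i = 0 := if_neg hi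

theorem finite_eq_one (ξ : RapidSeq) : {i | ξ i = 1}.Finite :=
  (finite_norm_ge ξ one_pos).subset fun i (hi : ξ i = 1) => by simp [hi]

/-- A closed subalgebra contains the spectral idempotent of each of its elements at `1`: it is the
limit of `ξ ^ m * p(ξ)`, where the polynomial `p` interpolates the large values of `ξ`. -/
theorem indicator_eq_one_mem (hE : IsClosed (E : Set RapidSeq)) {ξ : RapidSeq} (hξ : ξ ∈ E) :
    indicator (finite_eq_one ξ) ∈ E := by
  have hF := finite_norm_ge ξ (ε := 1 / 2) (by norm_num)
  classical
  -- The roots are the values of modulus at least `1 / 2`, except `1`.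
  obtain ⟨ζ, hζ, hζe⟩ := exists_mem_eq_mul_prod hξ ((hF.toFinset.image ξ.1).erase 1)
  refine mem_of_isClosed hE fun q ε hε => ?_
  obtain ⟨m, hm⟩ : ∃ m : ℕ, (1 / 2 : ℝ) ^ m * seminorm q ζ < ε := by
    have := (tendsto_pow_atTop_nhds_zero_of_lt_one (r := (1 / 2 : ℝ)) (by norm_num)
      (by norm_num)).mul_const (seminorm q ζ)
    rw [zero_mul] at this
    exact (this.eventually (gt_mem_nhds hε)).exists
  obtain ⟨η, hη, hηe⟩ := exists_mem_eq_pow_mul hξ hζ m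
  refine ⟨η, hη, (seminorm_le_of_norm_le (by positivity) fun i => ?_).trans_lt hm⟩
  rw [sub_apply, hηe]
  by_cases h1 : ξ i = 1
  · rw [indicator_of_mem _ h1, hζe, h1, one_pow, one_mul, one_mul, Finset.prod_eq_one, sub_self,
      norm_zero]
    · positivity
    · intro v hv
      exact div_self (sub_ne_zero.2 (Finset.ne_of_mem_erase hv).symm)
  rw [indicator_of_notMem _ h1, sub_zero]
  -- Large values are killed by `ζ`, small ones are damped by `(1 / 2) ^ m`.
  by_cases hi : 1 / 2 ≤ ‖ξ i‖
  · have : ζ i = 0 := by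
      rw [hζe, Finset.prod_eq_zero (i := ξ i), mul_zero]
      · exact Finset.mem_erase.2 ⟨h1, Finset.mem_image.2 ⟨i, hF.mem_toFinset.2 hi, rfl⟩⟩
      · rw [sub_self, zero_div]
    rw [this]
    simp
  · rw [norm_mul, norm_pow]
    have := (not_le.1 hi).le
    gcongr

/-! ### The classes of indices that a subalgebra does not separate -/

/-- The indices at which some element of `E` does not vanish. -/
def support (E : NonUnitalStarSubalgebra ℂ RapidSeq) : Set ℕ+ := {j | ∃ ξ ∈ E, ξ j ≠ 0}

/-- The indices that `E` does not separate from `j`. -/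
def block (E : NonUnitalStarSubalgebra ℂ RapidSeq) (j : ℕ+) : Set ℕ+ := {i | ∀ ξ ∈ E, ξ i = ξ j}

theorem finite_block {j : ℕ+} (hj : j ∈ support E) : (block E j).Finite := by
  obtain ⟨ξ, hξ, h⟩ := hj
  exact (finite_norm_ge ξ (norm_pos_iff.2 h)).subset fun i hi => by simp [hi ξ hξ]

/-- Take a set `T ∋ j` of least cardinality with indicator in `E`. An element separating two points
of `T` would yield a smaller one. -/
theorem indicator_block_mem (hE : IsClosed (E : Set RapidSeq)) {j : ℕ+} (hj : j ∈ support E) :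
    indicator (finite_block hj) ∈ E := by
  have hex : ∃ c : ℕ, ∃ (T : Set ℕ+) (hT : T.Finite), indicator hT ∈ E ∧ j ∈ T ∧ T.ncard = c := by
    obtain ⟨ξ, hξ, h⟩ := hj
    refine ⟨_, _, _, indicator_eq_one_mem hE (SMulMemClass.smul_mem (ξ j)⁻¹ hξ), ?_, rfl⟩
    exact inv_mul_cancel₀ h
  classical
  obtain ⟨T, hT, hTE, hjT, hc⟩ := Nat.find_spec hex
  suffices T = block E j by subst this; exact hTE
  refine Set.Subset.antisymm (fun i hi η hη => ?_) fun i hi => ?_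
  · by_contra hne
    -- `ζ` is `1 + η - η j` on `T` and `0` off it, so `{ζ = 1}` lies in `T`, contains `j` and misses
    -- `i`.
    set ζ := indicator hT + (η * indicator hT - η j • indicator hT) with hζ
    have hζE : ζ ∈ E := add_mem hTE (sub_mem (mul_mem hη hTE) (SMulMemClass.smul_mem _ hTE))
    have hζT : ∀ k ∈ T, ζ k = 1 + (η k - η j) := fun k hk => by
      simp [hζ, indicator_of_mem hT hk]
    have hss : {k | ζ k = 1} ⊂ T := by
      refine (Set.ssubset_iff_of_subset fun k (hk : ζ k = 1) => ?_).2 ⟨i, hi, fun h => ?_⟩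
      · by_contra hkT
        simp [hζ, indicator_of_notMem hT hkT] at hk
      · have h' : ζ i = 1 := h
        rw [hζT i hi, add_eq_left, sub_eq_zero] at h'
        exact hne h'
    refine Nat.find_min hex (m := {k | ζ k = 1}.ncard) ?_
      ⟨_, finite_eq_one ζ, indicator_eq_one_mem hE hζE, ?_, rfl⟩
    · rw [← hc]
      exact Set.ncard_lt_ncard hss hT
    · simp [hζT j hjT]
  · by_contra hiT
    have := hi _ hTE
    rw [indicator_of_mem hT hjT, indicator_of_notMem hT hiT] at this
    exact zero_ne_one this

/-- A closed subalgebra consists of the sequences which are constant on blocks and vanish outside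
the support. -/
theorem mem_of_const_on_blocks (hE : IsClosed (E : Set RapidSeq)) {ξ : RapidSeq}
    (h0 : ∀ j ∉ support E, ξ j = 0) (h : ∀ j ∈ support E, ∀ i ∈ block E j, ξ i = ξ j) :
    ξ ∈ E := by
  -- Built by adding whole blocks: if `v` is wrong at `k`, it vanishes on the block of `k`, and `ξ k
  -- • e` corrects it there.
  have happ : ∀ N : ℕ, ∃ v ∈ E, (∀ i, v i = ξ i ∨ v i = 0) ∧
      ∀ i : ℕ+, (i : ℕ) ≤ N → v i = ξ i := by
    intro N
    induction N with
    | zero => exact ⟨0, zero_mem E, by simp, fun i hi => absurd hi (by simp)⟩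
    | succ N ih =>
      obtain ⟨v, hv, hv0, hvN⟩ := ih
      set k : ℕ+ := N.succPNat with hk
      have hle : ∀ i : ℕ+, (i : ℕ) ≤ N + 1 → (i : ℕ) ≤ N ∨ i = k := fun i hi => by
        rcases Nat.le_succ_iff.1 hi with h | h
        · exact Or.inl h
        · exact Or.inr (PNat.eq h)
      by_cases hvk : v k = ξ k
      · refine ⟨v, hv, hv0, fun i hi => ?_⟩
        rcases hle i hi with h | rfl
        · exact hvN i h
        · exact hvk
      have hvk0 : v k = 0 := (hv0 k).resolve_left hvk
      have hkS : k ∈ support E := by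
        by_contra hkS
        exact hvk (hvk0.trans (h0 k hkS).symm)
      set e := indicator (finite_block hkS) with he
      have heq : ∀ i ∈ block E k, (v + ξ k • e) i = ξ i := fun i hi => by
        rw [add_apply, smul_apply, he, indicator_of_mem _ hi, hi v hv, hvk0, h k hkS i hi]
        ring
      have hne : ∀ i ∉ block E k, (v + ξ k • e) i = v i := fun i hi => by
        rw [add_apply, smul_apply, he, indicator_of_notMem _ hi]
        ring
      refine ⟨v + ξ k • e, add_mem hv (SMulMemClass.smul_mem _ (indicator_block_mem hE hkS)),
        fun i => ?_, fun i hi => ?_⟩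
      · by_cases hb : i ∈ block E k
        · exact Or.inl (heq i hb)
        · rw [hne i hb]
          exact hv0 i
      · by_cases hb : i ∈ block E k
        · exact heq i hb
        · rw [hne i hb]
          rcases hle i hi with h | rfl
          · exact hvN i h
          · exact absurd (fun η _ => rfl) hb
  refine mem_of_isClosed hE fun q ε hε => ?_
  set K := Real.sqrt (∑' j : ℕ+, ((j : ℝ) ^ 2)⁻¹)
  -- One extra power of `j` pays for the `ℓ²` sum, the other gives the gain `1 / N` on the tail.
  set C := seminorm (q + 2) ξ with hC
  obtain ⟨N, hN⟩ := exists_nat_gt (K * C / ε)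
  obtain ⟨v, hv, hv0, hvN⟩ := happ N
  have hC0 : 0 ≤ C := apply_nonneg _ _
  have hN0 : (0 : ℝ) < N := lt_of_le_of_lt (by positivity) hN
  refine ⟨v, hv, (seminorm_le_of_bound (C := C / N) (by positivity) fun j => ?_).trans_lt ?_⟩
  · rw [sub_apply, le_div_iff₀ hN0]
    by_cases hj : (j : ℕ) ≤ N
    · simpa [hvN j hj] using hC0
    · have hj' : (N : ℝ) ≤ j := by exact_mod_cast (not_le.1 hj).le
      have hn : ‖v j - ξ j‖ ≤ ‖ξ j‖ := by
        rcases hv0 j with h | h <;> simp [h]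
      calc ‖v j - ξ j‖ * (j : ℝ) ^ (q + 1) * N ≤ ‖ξ j‖ * (j : ℝ) ^ (q + 1) * j := by gcongr
        _ = ‖ξ j‖ * (j : ℝ) ^ (q + 2) := by ring
        _ ≤ C := norm_mul_pow_le_seminorm _ _ _
  · rw [div_lt_iff₀ hε] at hN
    rw [← mul_div_assoc, div_lt_iff₀ hN0]
    linarith

/-! ### Subalgebras of sequences constant on blocks -/

/-- `E` consists of the sequences which vanish outside `S` and whose value at `j ∈ S` is the value
at the representative `r j ≥ j`. -/
structure IsBlockAlgebra (E : NonUnitalStarSubalgebra ℂ RapidSeq) (S : Set ℕ+) (r : ℕ+ → ℕ+) :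
    Prop where
  le_repr : ∀ j ∈ S, j ≤ r j
  repr_mem : ∀ j ∈ S, r j ∈ S
  repr_repr : ∀ j ∈ S, r (r j) = r j
  mem_iff : ∀ ξ, ξ ∈ E ↔ (∀ j ∉ S, ξ j = 0) ∧ ∀ j ∈ S, ξ (r j) = ξ j

/-- The representative is the maximum of the block, which gives the inequality `j ≤ r j` needed for
continuity. -/
theorem exists_isBlockAlgebra (hE : IsClosed (E : Set RapidSeq)) :
    ∃ S r, IsBlockAlgebra E S r := by
  have hmax : ∀ j, ∃ m, j ∈ support E → m ∈ block E j ∧ ∀ i ∈ block E j, i ≤ m := by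
    intro j
    by_cases hj : j ∈ support E
    · obtain ⟨m, hm, hmax⟩ := Set.exists_max_image (block E j) id (finite_block hj)
        ⟨j, fun _ _ => rfl⟩
      exact ⟨m, fun _ => ⟨hm, hmax⟩⟩
    · exact ⟨j, fun h => absurd h hj⟩
  choose r hr using hmax
  have hself : ∀ j, j ∈ block E j := fun j _ _ => rfl
  have hmem : ∀ j ∈ support E, ∀ i ∈ block E j, i ∈ support E := by
    rintro j ⟨ξ, hξ, h⟩ i hi
    exact ⟨ξ, hξ, by rwa [hi ξ hξ]⟩
  have hrep : ∀ j ∈ support E, ∀ i ∈ block E j, r i = r j := by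
    intro j hj i hi
    have hb : block E i = block E j := by
      ext k
      exact forall₂_congr fun ξ hξ => by rw [hi ξ hξ]
    have h1 := hr i (hmem j hj i hi)
    have h2 := hr j hj
    rw [hb] at h1
    exact le_antisymm (h2.2 _ h1.1) (h1.2 _ h2.1)
  refine ⟨support E, r, fun j hj => (hr j hj).2 j (hself j), fun j hj => hmem j hj _ (hr j hj).1,
    fun j hj => hrep j hj _ (hr j hj).1, fun ξ => ⟨fun hξ => ⟨fun j hj => ?_, fun j hj =>
      (hr j hj).1 ξ hξ⟩, fun h => mem_of_const_on_blocks hE h.1 fun j hj i hi => ?_⟩⟩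
  · by_contra h
    exact hj ⟨ξ, hξ, h⟩
  · rw [← h.2 j hj, ← h.2 i (hmem j hj i hi), hrep j hj i hi]

end RapidSeq

/-! ### Restriction to representatives and expansion over blocks. -/

namespace RapidSeq

/-- The restriction of a rapidly decreasing sequence to the indices `n k`. -/
def restrict (n : ℕ+ → ℕ+) : RapidSeq →ₗ[ℂ] LambdaInf (KotheMatrix.powers n) where
  toFun ξ := ⟨fun k => ξ (n k), fun q => ⟨seminorm q ξ, by
    rintro _ ⟨k, rfl⟩
    exact norm_mul_pow_le_seminorm q ξ (n k)⟩⟩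
  map_add' _ _ := rfl
  map_smul' _ _ := rfl

@[simp] theorem restrict_apply (n : ℕ+ → ℕ+) (ξ : RapidSeq) (k : ℕ+) :
    restrict n ξ k = ξ (n k) := rfl

theorem continuous_restrict (n : ℕ+ → ℕ+) : Continuous (restrict n) := by
  refine withSeminorms.continuous_of_le LambdaInf.withSeminorms _ fun q => ⟨q, 1, fun ξ => ?_⟩
  rw [one_mul]
  exact ciSup_le fun k => norm_mul_pow_le_seminorm q ξ (n k)

open Classical in
/-- The terms of the sequence which is `η (κ j)` at `j ∈ S` and zero elsewhere. -/
noncomputable def expandFun (S : Set ℕ+) (κ : ℕ+ → ℕ+) (η : ℕ+ → ℂ) (j : ℕ+) : ℂ :=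
  if j ∈ S then η (κ j) else 0

theorem expandFun_of_mem {S : Set ℕ+} {κ : ℕ+ → ℕ+} {η : ℕ+ → ℂ} {j : ℕ+} (hj : j ∈ S) :
    expandFun S κ η j = η (κ j) := if_pos hj

theorem expandFun_of_notMem {S : Set ℕ+} {κ : ℕ+ → ℕ+} {η : ℕ+ → ℂ} {j : ℕ+} (hj : j ∉ S) :
    expandFun S κ η j = 0 := if_neg hj

theorem norm_expandFun_mul_pow_le {n : ℕ+ → ℕ+} {S : Set ℕ+} {κ : ℕ+ → ℕ+}
    (h : ∀ j ∈ S, j ≤ n (κ j)) (η : LambdaInf (KotheMatrix.powers n)) (q : ℕ) (j : ℕ+) :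
    ‖expandFun S κ η j‖ * (j : ℝ) ^ q ≤ LambdaInf.seminorm _ q η := by
  by_cases hj : j ∈ S
  · rw [expandFun_of_mem hj]
    refine le_trans ?_ (LambdaInf.norm_mul_entry_le_seminorm q η (κ j))
    have : (j : ℝ) ≤ n (κ j) := by exact_mod_cast h j hj
    exact mul_le_mul_of_nonneg_left (pow_le_pow_left₀ (by positivity) this q) (norm_nonneg _)
  · rw [expandFun_of_notMem hj, norm_zero, zero_mul]
    exact apply_nonneg _ _

/-- The map from `λ^∞(n_k^q)` to `s` given by `expandFun`. -/
noncomputable def expand {n : ℕ+ → ℕ+} {S : Set ℕ+} {κ : ℕ+ → ℕ+} (h : ∀ j ∈ S, j ≤ n (κ j)) :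
    LambdaInf (KotheMatrix.powers n) →ₗ[ℂ] RapidSeq where
  toFun η := ofBounds (expandFun S κ η) fun q => ⟨_, norm_expandFun_mul_pow_le h η q⟩
  map_add' η η' := ext fun j => by
    by_cases hj : j ∈ S
    · simp only [add_apply, ofBounds_apply, expandFun_of_mem hj]; rfl
    · simp only [add_apply, ofBounds_apply, expandFun_of_notMem hj, add_zero]
  map_smul' c η := ext fun j => by
    by_cases hj : j ∈ S
    · simp only [smul_apply, RingHom.id_apply, ofBounds_apply, expandFun_of_mem hj]; rfl
    · simp only [smul_apply, RingHom.id_apply, ofBounds_apply, expandFun_of_notMem hj, mul_zero]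

section

variable {n : ℕ+ → ℕ+} {S : Set ℕ+} {κ : ℕ+ → ℕ+} (h : ∀ j ∈ S, j ≤ n (κ j))
  (η : LambdaInf (KotheMatrix.powers n)) {j : ℕ+}

theorem expand_of_mem (hj : j ∈ S) : expand h η j = η (κ j) := expandFun_of_mem hj

theorem expand_of_notMem (hj : j ∉ S) : expand h η j = 0 := expandFun_of_notMem hj

theorem continuous_expand : Continuous (expand h) :=
  LambdaInf.withSeminorms.continuous_of_le withSeminorms _ fun q => ⟨q + 1, _, fun η =>
    seminorm_le_of_bound (apply_nonneg _ _) (norm_expandFun_mul_pow_le h η (q + 1))⟩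

end

namespace IsBlockAlgebra

variable {E : NonUnitalStarSubalgebra ℂ RapidSeq} {S : Set ℕ+} {r : ℕ+ → ℕ+}

/-- Replacing `ξ j` by `ξ (r j)` on `S`, and by `0` elsewhere, is a projection onto `E`; it is
`expand` after `restrict` with `n = id` and `κ = r`. -/
theorem closedComplemented (hE : IsBlockAlgebra E S r) :
    E.toNonUnitalSubalgebra.toSubmodule.ClosedComplemented := by
  have hle : ∀ j ∈ S, j ≤ id (r j) := hE.le_repr
  let P : RapidSeq →L[ℂ] RapidSeq :=
    ⟨expand hle ∘ₗ restrict id, (continuous_expand hle).comp (continuous_restrict id)⟩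
  have hmem : ∀ ξ j, j ∈ S → P ξ j = ξ (r j) := fun ξ j hj => expand_of_mem hle _ hj
  have hnot : ∀ ξ j, j ∉ S → P ξ j = 0 := fun ξ j hj => expand_of_notMem hle _ hj
  have hP : ∀ ξ, P ξ ∈ E.toNonUnitalSubalgebra.toSubmodule := fun ξ => by
    refine (hE.mem_iff _).2 ⟨hnot ξ, fun j hj => ?_⟩
    rw [hmem ξ j hj, hmem ξ _ (hE.repr_mem j hj), hE.repr_repr j hj]
  refine ⟨P.codRestrict _ hP, fun ξ => Subtype.ext (ext fun j => ?_)⟩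
  have hξ := (hE.mem_iff _).1 ξ.2
  by_cases hj : j ∈ S
  · exact (hmem _ j hj).trans (hξ.2 j hj)
  · exact (hnot _ j hj).trans (hξ.1 j hj).symm

/-- With `n (κ j) = r j` on `S`, restriction along `n` and expansion along `κ` are mutually inverse.
-/
theorem frechetStarIso (hE : IsBlockAlgebra E S r) {n : ℕ+ → ℕ+} (hn : Function.Injective n)
    (hrange : Set.range n = {j | j ∈ S ∧ r j = j}) :
    FrechetStarIso E (LambdaInf (KotheMatrix.powers n)) := by
  have hex : ∀ j, ∃ k, j ∈ S → n k = r j := by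
    intro j
    by_cases hj : j ∈ S
    · have : r j ∈ Set.range n := hrange ▸ ⟨hE.repr_mem j hj, hE.repr_repr j hj⟩
      obtain ⟨k, hk⟩ := this
      exact ⟨k, fun _ => hk⟩
    · exact ⟨j, fun h => absurd h hj⟩
  choose κ hκ using hex
  have hle : ∀ j ∈ S, j ≤ n (κ j) := fun j hj => (hκ j hj).symm ▸ hE.le_repr j hj
  have hnS : ∀ k, n k ∈ S ∧ r (n k) = n k := fun k =>
    (hrange ▸ Set.mem_range_self k : n k ∈ {j | j ∈ S ∧ r j = j})
  have hmem : ∀ η, expand hle η ∈ E := fun η => by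
    refine (hE.mem_iff _).2 ⟨fun j hj => expand_of_notMem hle η hj, fun j hj => ?_⟩
    have hrj := hE.repr_mem j hj
    rw [expand_of_mem hle η hj, expand_of_mem hle η hrj]
    refine congrArg η.1 (hn ?_)
    rw [hκ j hj, hκ _ hrj, hE.repr_repr j hj]
  refine ⟨{ toFun := fun ξ => restrict n ξ
            invFun := fun η => ⟨expand hle η, hmem η⟩
            left_inv := fun ξ => Subtype.ext (ext fun j => ?_)
            right_inv := fun η => LambdaInf.ext fun k => ?_
            map_mul' := fun _ _ => rfl
            map_add' := fun _ _ => rfl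
            map_star' := fun _ => rfl
            map_smul' := fun _ _ => rfl }, ?_, ?_⟩
  · have hξ := (hE.mem_iff _).1 ξ.2
    by_cases hj : j ∈ S
    · refine (expand_of_mem hle _ hj).trans ?_
      rw [restrict_apply, hκ j hj]
      exact hξ.2 j hj
    · exact (expand_of_notMem hle _ hj).trans (hξ.1 j hj).symm
  · rw [restrict_apply]
    refine (expand_of_mem hle η (hnS k).1).trans ?_
    refine congrArg η.1 (hn ?_)
    rw [hκ _ (hnS k).1, (hnS k).2]
  · exact (continuous_restrict n).comp continuous_subtype_val
  · exact (continuous_expand hle).subtype_mk hmem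

/-- Values at the representatives determine an element of `E`. -/
theorem infinite_representatives (hE : IsBlockAlgebra E S r) (hfin : ¬ FiniteDimensional ℂ E) :
    {j | j ∈ S ∧ r j = j}.Infinite := by
  intro h
  have := h.to_subtype
  let L : E →ₗ[ℂ] ({j | j ∈ S ∧ r j = j} → ℂ) :=
    LinearMap.pi fun j => evalₗ j ∘ₗ E.toNonUnitalSubalgebra.toSubmodule.subtype
  refine hfin (FiniteDimensional.of_injective L fun ξ η hξη => Subtype.ext (ext fun j => ?_))
  have hξ := (hE.mem_iff _).1 ξ.2
  have hη := (hE.mem_iff _).1 η.2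
  by_cases hj : j ∈ S
  · rw [← hξ.2 j hj, ← hη.2 j hj]
    exact congrFun hξη ⟨r j, hE.repr_mem j hj, hE.repr_repr j hj⟩
  · rw [hξ.1 j hj, hη.1 j hj]

end IsBlockAlgebra

/-! ### Enumeration of infinite sets, and sequences with prescribed support. -/

theorem exists_strictMono_range_eq {T : Set ℕ+} (hT : T.Infinite) :
    ∃ n : ℕ+ → ℕ+, StrictMono n ∧ Set.range n = T := by
  let f := OrderIso.pnatIsoNat
  have hinf : (f '' T).Infinite := hT.image f.injective.injOn
  have := hinf.to_subtype
  classical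
  let g := Nat.Subtype.orderIsoOfNat (f '' T)
  refine ⟨fun k => f.symm (g (f k)), fun a b hab => ?_, ?_⟩
  · exact f.symm.strictMono (g.strictMono (f.strictMono hab))
  · ext j
    constructor
    · rintro ⟨k, rfl⟩
      obtain ⟨i, hi, h⟩ := (g (f k)).2
      simpa [← h] using hi
    · intro hj
      exact ⟨f.symm (g.symm ⟨f j, j, hj, rfl⟩), by simp⟩

/-- The subalgebra of the sequences which vanish outside `S`. -/
def supportedIn (S : Set ℕ+) : NonUnitalStarSubalgebra ℂ RapidSeq where
  carrier := {ξ | ∀ j ∉ S, ξ j = 0}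
  zero_mem' := fun _ _ => rfl
  add_mem' := fun hξ hη j hj => by rw [add_apply, hξ j hj, hη j hj, add_zero]
  mul_mem' := fun hξ _ j hj => by rw [mul_apply, hξ j hj, zero_mul]
  smul_mem' := fun c ξ hξ j hj => by rw [smul_apply, hξ j hj, mul_zero]
  star_mem' := fun hξ j hj => by rw [star_apply, hξ j hj, star_zero]

theorem mem_supportedIn {S : Set ℕ+} {ξ : RapidSeq} :
    ξ ∈ supportedIn S ↔ ∀ j ∉ S, ξ j = 0 := Iff.rfl

theorem isClosed_supportedIn (S : Set ℕ+) : IsClosed (supportedIn S : Set RapidSeq) := by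
  have : (supportedIn S : Set RapidSeq) = ⋂ j, ⋂ (_ : j ∉ S), {ξ : RapidSeq | ξ j = 0} := by
    ext ξ
    simp only [SetLike.mem_coe, mem_supportedIn, Set.mem_iInter, Set.mem_ofPred_eq]
  rw [this]
  exact isClosed_biInter fun j _ => isClosed_singleton.preimage (continuous_apply j)

theorem isBlockAlgebra_supportedIn (S : Set ℕ+) : IsBlockAlgebra (supportedIn S) S id where
  le_repr _ _ := le_rfl
  repr_mem _ hj := hj
  repr_repr _ _ := rfl
  mem_iff ξ := by simp [mem_supportedIn]

/-- The indicators of the points of `S` are independent, as the evaluations show. -/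
theorem not_finiteDimensional_supportedIn {S : Set ℕ+} (hS : S.Infinite) :
    ¬ FiniteDimensional ℂ (supportedIn S) := by
  intro hfin
  have := hS.to_subtype
  let v : S → supportedIn S := fun j => ⟨indicator (Set.finite_singleton (j : ℕ+)), fun i hi =>
    indicator_of_notMem _ fun h => hi (Set.mem_singleton_iff.1 h ▸ j.2)⟩
  have hv : LinearIndependent ℂ v := by
    rw [linearIndependent_iff']
    intro s g hg i hi
    let L := evalₗ i ∘ₗ (supportedIn S).toNonUnitalSubalgebra.toSubmodule.subtype
    have hL : ∀ j, L (v j) = if j = i then 1 else 0 := fun j => by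
      split_ifs with h
      · exact indicator_of_mem (Set.finite_singleton _) (congrArg Subtype.val h.symm)
      · exact indicator_of_notMem (Set.finite_singleton _) fun h' => h (Subtype.ext h'.symm)
    have h0 : L (∑ j ∈ s, g j • v j) = 0 := by rw [hg]; rfl
    have h1 : L (∑ j ∈ s, g j • v j) = ∑ j ∈ s, g j * L (v j) := by
      rw [map_sum]; rfl
    rw [h1] at h0
    simpa [hL, hi] using h0
  have := hv.finite
  exact not_finite S

end RapidSeq

theorem mainTheorem6 :
    (∀ E : NonUnitalStarSubalgebra ℂ RapidSeq,
      IsClosed (E : Set RapidSeq) → ¬ FiniteDimensional ℂ E →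
        ∃ n : ℕ+ → ℕ+, StrictMono n ∧ FrechetStarIso E (LambdaInf (KotheMatrix.powers n))) ∧
    (∀ n : ℕ+ → ℕ+, StrictMono n →
      ∃ E : NonUnitalStarSubalgebra ℂ RapidSeq,
        IsClosed (E : Set RapidSeq) ∧ ¬ FiniteDimensional ℂ E ∧
          FrechetStarIso (LambdaInf (KotheMatrix.powers n)) E) ∧
    (∀ E : NonUnitalStarSubalgebra ℂ RapidSeq,
      IsClosed (E : Set RapidSeq) →
        E.toNonUnitalSubalgebra.toSubmodule.ClosedComplemented) := by
  refine ⟨fun E hE hfin => ?_, fun n hn => ?_, fun E hE => ?_⟩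
  · obtain ⟨S, r, h⟩ := RapidSeq.exists_isBlockAlgebra hE
    obtain ⟨n, hn, hrange⟩ :=
      RapidSeq.exists_strictMono_range_eq (h.infinite_representatives hfin)
    exact ⟨n, hn, h.frechetStarIso hn.injective hrange⟩
  · refine ⟨RapidSeq.supportedIn (Set.range n), RapidSeq.isClosed_supportedIn _,
      RapidSeq.not_finiteDimensional_supportedIn (Set.infinite_range_of_injective hn.injective), ?_⟩
    obtain ⟨Φ, hΦ, hΦ'⟩ := (RapidSeq.isBlockAlgebra_supportedIn (Set.range n)).frechetStarIso
      hn.injective (by ext j; simp)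
    exact ⟨Φ.symm, hΦ', hΦ⟩
  · obtain ⟨S, r, h⟩ := RapidSeq.exists_isBlockAlgebra hE
    exact h.closedComplemented
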